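/- \textbf{Theorem (type I linear forms at unity).} Write $(x)_n=x(x+1)\cdots(x+n-1)$, $(x)_0=1$, for the Pochhammer symbol. Let $a,b,c,d\in\mathbb R$ and $\delta:=c+d-a-b$ satisfy $$a,b,\delta>0,\qquad c,\,d,\,d-a,\,d-b,\,c+1-a,\,c-b\notin\{0,-1,-2,\dots\}.$$ On $(0,1]$ consider the weights $$w_1(x)={}_2F_1\!\left[{c-b,\;d-b\atop \delta};1-x\right],\qquad w_2(x)=\frac{c}{b}\,{}_2F_1\!\left[{c-b,\;d-b-1\atop \delta};1-x\right],$$ and on $(0,1)$ the (possibly signed) measure $$d\mu(x)=\frac{\Gamma(c)\Gamma(d)}{\Gamma(a)\Gamma(b)\Gamma(\delta)}\,x^{a-1}(1-x)^{\delta-1}\,dx .$$ Then for every $n\in\mathbb N_0$ there is exactly one pair of real polynomials $(A_1^{(n)},A_2^{(n)})$ with $\deg A_1^{(n)}\le\lfloor n/2\rfloor$, $\deg A_2^{(n)}\le\lfloor (n+1)/2\rfloor-1$ (so $A_2^{(0)}=0$) whose type I linear form $$q^{(n)}(x):=w_1(x)A_1^{(n)}(x)+w_2(x)A_2^{(n)}(x)$$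 satisfies, with integrable integrands, $$\int_0^1x^kq^{(n)}(x)\,d\mu(x)=0\quad(0\le k\le n-1),\qquad \int_0^1x^nq^{(n)}(x)\,d\mu(x)=1 .$$ For every $n\in\mathbb N_0$ the values of these linear forms at $x=1$ are $$q^{(2n)}(1)=\frac{1}{(2n)!}\frac{(c)_{3n}(d)_{3n}}{(a)_{2n}(b)_{2n}},\qquad q^{(2n+1)}(1)=\frac{1}{(2n+1)!}\frac{(c)_{3n+2}(d)_{3n+1}}{(a)_{2n+1}(b)_{2n+1}} .$$ Consequently, if moreover $c,d>0$, then $q^{(n)}(1)>0$ for all $n\in\mathbb N_0$. -/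

import Mathlib

open Polynomial Nat

noncomputable section

namespace HypergeometricMOP

/-- The Pochhammer symbol `(x)_n = x (x + 1) ⋯ (x + n - 1)`, with `(x)_0 = 1`. -/
def poch (x : ℝ) (n : ℕ) : ℝ := (ascPochhammer ℝ n).eval x

/-- `δ = c + d - a - b`. -/
def delta (a b c d : ℝ) : ℝ := c + d - a - b

/-- The first weight `w₁(x) = ₂F₁(c - b, d - b; δ; 1 - x)`. -/
def w₁ (a b c d : ℝ) (x : ℝ) : ℝ :=
  ordinaryHypergeometric (c - b) (d - b) (delta a b c d) (1 - x)

/-- The second weight `w₂(x) = (c / b) ₂F₁(c - b, d - b - 1; δ; 1 - x)`. -/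
def w₂ (a b c d : ℝ) (x : ℝ) : ℝ :=
  c / b * ordinaryHypergeometric (c - b) (d - b - 1) (delta a b c d) (1 - x)

/-- The density, with respect to Lebesgue measure on `(0, 1)`, of the (possibly signed) measure
`dμ(x) = Γ(c) Γ(d) / (Γ(a) Γ(b) Γ(δ)) x^(a - 1) (1 - x)^(δ - 1) dx`. -/
def density (a b c d : ℝ) (x : ℝ) : ℝ :=
  Real.Gamma c * Real.Gamma d / (Real.Gamma a * Real.Gamma b * Real.Gamma (delta a b c d)) *
    x ^ (a - 1) * (1 - x) ^ (delta a b c d - 1)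

/-- The linear form `u₁ A₁ + u₂ A₂` with weight functions `u₁, u₂` and polynomials `A₁, A₂`. -/
def linearForm (u₁ u₂ : ℝ → ℝ) (A₁ A₂ : ℝ[X]) (x : ℝ) : ℝ :=
  u₁ x * A₁.eval x + u₂ x * A₂.eval x

/-- `A₁, A₂` are type I multiple orthogonal polynomials of multi-index `(ν₁, ν₂)` for the system
`(u₁, u₂, ρ(x) dx)` on `(0, 1)`: `deg A₁ ≤ ν₁ - 1`, `deg A₂ ≤ ν₂ - 1` (so that a polynomial whose
index is `0` vanishes), the linear form is orthogonal to `x ^ j` for `j ≤ ν₁ + ν₂ - 2`, and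
its moment of order `ν₁ + ν₂ - 1` is normalized to be `1`. -/
structure IsTypeI (u₁ u₂ ρ : ℝ → ℝ) (ν₁ ν₂ : ℕ) (A₁ A₂ : ℝ[X]) : Prop where
  degree_fst : A₁.degree < ν₁
  degree_snd : A₂.degree < ν₂
  integrable : ∀ j : ℕ, j + 1 ≤ ν₁ + ν₂ →
    MeasureTheory.IntegrableOn (fun x => x ^ j * linearForm u₁ u₂ A₁ A₂ x * ρ x) (Set.Ioo 0 1)
  orthogonal : ∀ j : ℕ, j + 2 ≤ ν₁ + ν₂ →
    ∫ x in Set.Ioo (0 : ℝ) 1, x ^ j * linearForm u₁ u₂ A₁ A₂ x * ρ x = 0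
  normalized : ∀ j : ℕ, j + 1 = ν₁ + ν₂ →
    ∫ x in Set.Ioo (0 : ℝ) 1, x ^ j * linearForm u₁ u₂ A₁ A₂ x * ρ x = 1

/-- `A₁, A₂` are the `n`-th type I polynomials on the step-line of the hypergeometric system
`(w₁, w₂, dμ)`. The multi-index is `(m + 1, m)` for `n = 2 m` and `(m + 1, m + 1)`
for `n = 2 m + 1`. -/
def IsHypergeometricTypeI (a b c d : ℝ) (n : ℕ) (A₁ A₂ : ℝ[X]) : Prop :=
  IsTypeI (w₁ a b c d) (w₂ a b c d) (density a b c d) (n / 2 + 1) ((n + 1) / 2) A₁ A₂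

/-- The linear form `q(x) = w₁(x) A₁(x) + w₂(x) A₂(x)`. -/
def q (a b c d : ℝ) (A₁ A₂ : ℝ[X]) (x : ℝ) : ℝ :=
  linearForm (w₁ a b c d) (w₂ a b c d) A₁ A₂ x

end HypergeometricMOP

end

namespace HypergeometricMOP

open Filter Topology MeasureTheory

/-! Gauss's theorem gives the `k`-th moment of `w₁ dμ` as `m_k = (a)_k (b)_k / ((c)_k (d)_k)`, and
`w₂ dμ` is `w₁ dμ` with `b, c` replaced by `b + 1, c + 1`. Let `u = b, a, b + 1, a + 1, …` and `v =
c, d, c + 1, d + 1, …`. Then the `k`-th moment of `x^i w₁` is `m_k ∏_{r < 2i} (k + u_r) / (k +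
v_r)`, and that of `x^i w₂` is `c / b` times the same expression with `2i + 1` factors. If `γ_0, …,
γ_n` lists the coefficients of `A₁` and `(c / b) A₂` alternately, the `k`-th moment of `q` is
therefore `m_k P(k) / V(k)`, where `V(x) = ∏_{r < n} (x + v_r)` and `P = ∑ γ_j ∏_{r < j} (x + u_r)
∏_{j ≤ r < n} (x + v_r)`.

The type I conditions now read `P(k) = 0` for `k < n` and `P(n) = V(n) / m_n`. As `deg P ≤ n`, this
forces `P = λ x (x - 1) ⋯ (x - n + 1)` with `n! λ = V(n) / m_n`. All products in `P` are monic of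
degree `n`, so `λ = ∑ γ_j`, and this sum is `q(1)` because both `₂F₁` equal `1` at argument `0`
(`q_one_eq`). Existence and uniqueness amount to linear independence of these products
(`eq_zero_of_sum_mixedProd_eq_zero`), which needs `v_s ≠ u_r` for `r ≤ s`; the four conditions on `d
- a`, `d - b`, `c + 1 - a`, `c - b` provide this. -/

/-! ### Pochhammer asymptotics and Gauss's summation theorem -/

theorem ascPochhammer_eval_eq_prod_range (n : ℕ) (x : ℝ) :
    (ascPochhammer ℝ n).eval x = ∏ j ∈ Finset.range n, (x + j) := by
  induction n with
  | zero => simp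
  | succ n ih => rw [ascPochhammer_succ_eval, ih, Finset.prod_range_succ]

theorem Gamma_add_natCast {x : ℝ} (hx : ∀ k : ℕ, x ≠ -(k : ℝ)) (n : ℕ) :
    Real.Gamma (x + n) = (ascPochhammer ℝ n).eval x * Real.Gamma x := by
  induction n with
  | zero => simp
  | succ n ih =>
    rw [ascPochhammer_succ_eval, Nat.cast_succ, ← add_assoc, Real.Gamma_add_one, ih]
    · ring
    · intro h
      exact hx n (by linarith)

theorem ne_neg_natCast_of_pos {x : ℝ} (hx : 0 < x) (k : ℕ) : x ≠ -(k : ℝ) := by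
  have : (0 : ℝ) ≤ k := k.cast_nonneg
  linarith

/-- This is Euler's limit for `1 / Γ`. It also holds at the poles: there `Real.Gamma x = 0`, so the
inverse is `0`, and the Pochhammer symbols eventually vanish. -/
theorem tendsto_ascPochhammer_div (x : ℝ) :
    Tendsto (fun n : ℕ => (ascPochhammer ℝ (n + 1)).eval x / ((n : ℝ) ^ x * n !)) atTop
      (𝓝 (Real.Gamma x)⁻¹) := by
  have key : (fun n : ℕ => (ascPochhammer ℝ (n + 1)).eval x / ((n : ℝ) ^ x * n !)) =
      fun n => (Real.GammaSeq x n)⁻¹ := by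
    funext n
    rw [Real.GammaSeq, inv_div, ascPochhammer_eval_eq_prod_range]
  by_cases h : Real.Gamma x = 0
  · obtain ⟨m, rfl⟩ := (Real.Gamma_eq_zero_iff x).1 h
    rw [h, inv_zero]
    refine tendsto_const_nhds.congr' ?_
    filter_upwards [eventually_ge_atTop m] with n hn
    rw [ascPochhammer_eval_neg_coe_nat_of_lt (by omega), zero_div]
  · rw [key]
    exact (Real.GammaSeq_tendsto_Gamma x).inv₀ h

/-- Combining three Euler limits leaves a single `n!` in the denominator; the factor `n + 1` turns
it into the `(n + 1)!` of the coefficient. So the coefficients are `O(n ^ (A + B - C - 1))`. -/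
theorem tendsto_coefficient_div (A B : ℝ) {C : ℝ} (hC : 0 < C) :
    Tendsto (fun n : ℕ => ordinaryHypergeometricCoefficient A B C (n + 1) * ((n : ℝ) + 1) /
      (n : ℝ) ^ (A + B - C)) atTop
      (𝓝 ((Real.Gamma A)⁻¹ * (Real.Gamma B)⁻¹ / (Real.Gamma C)⁻¹)) := by
  refine (((tendsto_ascPochhammer_div A).mul (tendsto_ascPochhammer_div B)).div
    (tendsto_ascPochhammer_div C) (inv_ne_zero (Real.Gamma_pos_of_pos hC).ne')).congr' ?_
  filter_upwards [eventually_gt_atTop 0] with n hn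
  have hn' : (0 : ℝ) < n := by exact_mod_cast hn
  have hf : (n ! : ℝ) ≠ 0 := by positivity
  have hp := (ascPochhammer_pos (n + 1) C hC).ne'
  have h1 := (Real.rpow_pos_of_pos hn' A).ne'
  have h2 := (Real.rpow_pos_of_pos hn' B).ne'
  have h3 := (Real.rpow_pos_of_pos hn' C).ne'
  simp only [Pi.div_apply, ordinaryHypergeometricCoefficient]
  rw [Real.rpow_sub hn', Real.rpow_add hn', Nat.factorial_succ, Nat.cast_mul, Nat.cast_succ]
  have hn1 : (n : ℝ) + 1 ≠ 0 := by positivity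
  field_simp

theorem tendsto_succ_mul_coefficient {A B C : ℝ} (hC : 0 < C) (h : 0 < C - A - B) :
    Tendsto (fun n : ℕ => (n : ℝ) * ordinaryHypergeometricCoefficient A B C n) atTop (𝓝 0) := by
  rw [← tendsto_add_atTop_iff_nat 1]
  have h0 : Tendsto (fun n : ℕ => (n : ℝ) ^ (A + B - C)) atTop (𝓝 0) := by
    have := (tendsto_rpow_neg_atTop h).comp tendsto_natCast_atTop_atTop
    refine this.congr fun n => ?_
    simp only [Function.comp]
    congr 1
    ring
  have := (tendsto_coefficient_div A B hC).mul h0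
  rw [mul_zero] at this
  refine this.congr' ?_
  filter_upwards [eventually_gt_atTop 0] with n hn
  have hn' : (0 : ℝ) < n := by exact_mod_cast hn
  rw [div_mul_cancel₀ _ (Real.rpow_pos_of_pos hn' _).ne']
  push_cast
  ring

theorem summable_coefficient {A B C : ℝ} (hC : 0 < C) (h : 0 < C - A - B) :
    Summable (fun n : ℕ => ordinaryHypergeometricCoefficient A B C n) := by
  rw [← summable_nat_add_iff 1]
  refine summable_of_isBigO_nat
    (Real.summable_nat_rpow.2 (show A + B - C - 1 < -1 by linarith)) ?_
  have h1 := (tendsto_coefficient_div A B hC).isBigO_one ℝ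
  refine Asymptotics.IsBigO.trans (g := fun n : ℕ =>
    (n : ℝ) ^ (A + B - C) / ((n : ℝ) + 1)) ?_ ?_
  · have := h1.mul (Asymptotics.isBigO_refl
      (fun n : ℕ => (n : ℝ) ^ (A + B - C) / ((n : ℝ) + 1)) atTop)
    refine this.congr' ?_ ?_
    · filter_upwards [eventually_gt_atTop 0] with n hn
      have hn' : (0 : ℝ) < n := by exact_mod_cast hn
      have h1 := (Real.rpow_pos_of_pos hn' (A + B - C)).ne'
      have hn1 : (n : ℝ) + 1 ≠ 0 := by positivity
      field_simp
    · exact Eventually.of_forall fun n => one_mul _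
  · refine Asymptotics.IsBigO.of_bound 1 ?_
    filter_upwards [eventually_gt_atTop 0] with n hn
    have hn' : (0 : ℝ) < n := by exact_mod_cast hn
    rw [one_mul, Real.norm_of_nonneg (by positivity), Real.norm_of_nonneg (by positivity),
      Real.rpow_sub hn' (A + B - C) 1, Real.rpow_one]
    gcongr
    linarith

/-- The contiguous relation between `C` and `C + 1`, written termwise as a difference so that it can
be summed. -/
theorem coefficient_telescope (A B : ℝ) {C : ℝ} (hC : 0 < C) (n : ℕ) :
    C * (C - A - B) * ordinaryHypergeometricCoefficient A B C n -
      (C - A) * (C - B) * ordinaryHypergeometricCoefficient A B (C + 1) n =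
    -C * (((n + 1 : ℕ) : ℝ) * ordinaryHypergeometricCoefficient A B C (n + 1)) -
      -C * ((n : ℝ) * ordinaryHypergeometricCoefficient A B C n) := by
  have hp := (ascPochhammer_pos n C hC).ne'
  have hp1 := (ascPochhammer_pos n (C + 1) (by linarith)).ne'
  have hCn : C + n ≠ 0 := by positivity
  have hrec : (ascPochhammer ℝ n).eval (C + 1) = (ascPochhammer ℝ n).eval C * (C + n) / C := by
    rw [eq_div_iff hC.ne', ← ascPochhammer_succ_eval, ascPochhammer_succ_left]
    simp [mul_comm]
  have hf : (n ! : ℝ) ≠ 0 := by positivity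
  have hn1 : (n : ℝ) + 1 ≠ 0 := by positivity
  simp only [ordinaryHypergeometricCoefficient, ascPochhammer_succ_eval, hrec,
    Nat.factorial_succ, Nat.cast_mul, Nat.cast_succ]
  field_simp
  ring

/-- The partial sums telescope, and the boundary term tends to `0` because `C - A - B > 0`. -/
theorem tsum_coefficient_recurrence {A B C : ℝ} (hC : 0 < C) (h : 0 < C - A - B) :
    C * (C - A - B) * ∑' n, ordinaryHypergeometricCoefficient A B C n =
      (C - A) * (C - B) * ∑' n, ordinaryHypergeometricCoefficient A B (C + 1) n := by
  have s1 := (summable_coefficient hC h).mul_left (C * (C - A - B))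
  have s2 := (summable_coefficient (A := A) (B := B) (show 0 < C + 1 by linarith)
    (by linarith)).mul_left ((C - A) * (C - B))
  rw [← sub_eq_zero, ← tsum_mul_left, ← tsum_mul_left, ← s1.tsum_sub s2]
  refine tendsto_nhds_unique (s1.sub s2).hasSum.tendsto_sum_nat ?_
  have := (tendsto_succ_mul_coefficient hC h).const_mul (-C)
  rw [mul_zero] at this
  refine this.congr fun N => ?_
  rw [Finset.sum_congr rfl fun n _ => coefficient_telescope A B hC n, Finset.sum_range_sub
    (fun n : ℕ => -C * ((n : ℝ) * ordinaryHypergeometricCoefficient A B C n))]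
  simp

theorem tsum_coefficient_recurrence_iterate {A B C : ℝ} (hC : 0 < C) (h : 0 < C - A - B) (N : ℕ) :
    (ascPochhammer ℝ N).eval C * (ascPochhammer ℝ N).eval (C - A - B) *
        ∑' n, ordinaryHypergeometricCoefficient A B C n =
      (ascPochhammer ℝ N).eval (C - A) * (ascPochhammer ℝ N).eval (C - B) *
        ∑' n, ordinaryHypergeometricCoefficient A B (C + N) n := by
  induction N with
  | zero => simp
  | succ N ih =>
    have hN : (0 : ℝ) ≤ N := N.cast_nonneg
    have := tsum_coefficient_recurrence (A := A) (B := B) (show 0 < C + N by linarith)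
      (by linarith)
    simp only [ascPochhammer_succ_eval, Nat.cast_succ, ← add_assoc]
    linear_combination (C + N) * (C - A - B + N) * ih +
      (ascPochhammer ℝ N).eval (C - A) * (ascPochhammer ℝ N).eval (C - B) * this

/-- Only the term `n = 0` survives, since `(C + N)_n → ∞` for `n ≥ 1`. The series at `N = 0`
dominates because `(C + N)_n ≥ (C)_n > 0`. -/
theorem tendsto_tsum_coefficient {A B C : ℝ} (hC : 0 < C) (h : 0 < C - A - B) :
    Tendsto (fun N : ℕ => ∑' n, ordinaryHypergeometricCoefficient A B (C + N) n) atTop (𝓝 1) := by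
  have h1 : ∑' n, (if n = 0 then (1 : ℝ) else 0) = 1 := tsum_ite_eq 0 _
  rw [← h1]
  refine tendsto_tsum_of_dominated_convergence (summable_coefficient hC h).norm ?_ ?_
  · rintro (_ | k)
    · simp [ordinaryHypergeometricCoefficient]
    · rw [if_neg (by omega)]
      have ht : Tendsto (fun N : ℕ => (ascPochhammer ℝ (k + 1)).eval (C + N)) atTop atTop := by
        have h2 : Tendsto (fun N : ℕ => C + (N : ℝ)) atTop atTop :=
          tendsto_atTop_add_const_left _ _ tendsto_natCast_atTop_atTop
        refine ((ascPochhammer ℝ (k + 1)).tendsto_atTop_of_leadingCoeff_nonneg ?_ ?_).comp h2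
        · rw [← natDegree_pos_iff_degree_pos, ascPochhammer_natDegree]
          omega
        · rw [(monic_ascPochhammer ℝ (k + 1)).leadingCoeff]
          exact zero_le_one
      simpa [ordinaryHypergeometricCoefficient] using
        ht.inv_tendsto_atTop.const_mul
          (((k + 1)! : ℝ)⁻¹ * (ascPochhammer ℝ (k + 1)).eval A * (ascPochhammer ℝ (k + 1)).eval B)
  · refine Eventually.of_forall fun N k => ?_
    have hp := ascPochhammer_pos k C hC
    have hle : (ascPochhammer ℝ k).eval C ≤ (ascPochhammer ℝ k).eval (C + N) := by
      simp only [ascPochhammer_eval_eq_prod_range]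
      refine Finset.prod_le_prod (fun i _ => by positivity) fun i _ => ?_
      have hN : (0 : ℝ) ≤ N := N.cast_nonneg
      linarith
    simp only [ordinaryHypergeometricCoefficient, norm_mul]
    refine mul_le_mul_of_nonneg_left ?_ (by positivity)
    rw [norm_inv, norm_inv, Real.norm_of_nonneg hp.le, Real.norm_of_nonneg (hp.le.trans hle)]
    exact inv_anti₀ hp hle

/-- Gauss's summation theorem. -/
theorem tsum_coefficient_eq {A B C : ℝ} (hC : 0 < C) (h : 0 < C - A - B) :
    ∑' n, ordinaryHypergeometricCoefficient A B C n =
      Real.Gamma C * Real.Gamma (C - A - B) / (Real.Gamma (C - A) * Real.Gamma (C - B)) := by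
  -- Let the number of shifts in the iterated recurrence tend to infinity. Both sides are scaled
  -- alike, since `C + (C - A - B) = (C - A) + (C - B)`.
  have hl := ((tendsto_ascPochhammer_div C).mul (tendsto_ascPochhammer_div (C - A - B))).mul_const
    (∑' n, ordinaryHypergeometricCoefficient A B C n)
  have hr := ((tendsto_ascPochhammer_div (C - A)).mul (tendsto_ascPochhammer_div (C - B))).mul
    ((tendsto_add_atTop_iff_nat 1).2 (tendsto_tsum_coefficient hC h))
  have key := tendsto_nhds_unique_of_eventuallyEq hl hr ?_
  · have g1 := (Real.Gamma_pos_of_pos hC).ne'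
    have g2 := (Real.Gamma_pos_of_pos h).ne'
    rw [mul_one, ← mul_inv, ← mul_inv, inv_mul_eq_iff_eq_mul₀ (mul_ne_zero g1 g2)] at key
    rw [key, div_eq_mul_inv]
  · filter_upwards [eventually_gt_atTop 0] with n hn
    have hn' : (0 : ℝ) < n := by exact_mod_cast hn
    have hf : (n ! : ℝ) ≠ 0 := by positivity
    have hq := tsum_coefficient_recurrence_iterate hC h (n + 1)
    have e : (n : ℝ) ^ C * (n : ℝ) ^ (C - A - B) = (n : ℝ) ^ (C - A) * (n : ℝ) ^ (C - B) := by
      rw [← Real.rpow_add hn', ← Real.rpow_add hn']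
      congr 1
      ring
    have h1 := (Real.rpow_pos_of_pos hn' C).ne'
    have h2 := (Real.rpow_pos_of_pos hn' (C - A - B)).ne'
    rw [_root_.div_mul_div_comm, _root_.div_mul_div_comm, div_mul_eq_mul_div, div_mul_eq_mul_div, hq,
      mul_mul_mul_comm, e, mul_mul_mul_comm ((n : ℝ) ^ (C - A))]

/-! ### Beta integrals and the integral of a hypergeometric function -/

theorem integral_rpow_mul_one_sub_rpow {u v : ℝ} (hu : 0 < u) (hv : 0 < v) :
    ∫ x in Set.Ioo (0 : ℝ) 1, x ^ (u - 1) * (1 - x) ^ (v - 1) =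
      Real.Gamma u * Real.Gamma v / Real.Gamma (u + v) := by
  rw [← ProbabilityTheory.beta, ProbabilityTheory.beta_eq_betaIntegralReal u v hu hv,
    Complex.betaIntegral, intervalIntegral.integral_of_le zero_le_one,
    ← integral_Ioc_eq_integral_Ioo, ← RCLike.re_to_complex, ← integral_re]
  · refine setIntegral_congr_fun measurableSet_Ioc fun x hx => ?_
    have h1 : 0 ≤ 1 - x := sub_nonneg.2 hx.2
    norm_cast
    rw [← Complex.ofReal_cpow hx.1.le, ← Complex.ofReal_cpow h1, RCLike.re_to_complex,
      Complex.re_mul_ofReal, Complex.ofReal_re]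
  · have := Complex.betaIntegral_convergent (u := u) (v := v) (by simpa) (by simpa)
    rwa [intervalIntegrable_iff_integrableOn_Ioc_of_le zero_le_one, IntegrableOn] at this

theorem integrableOn_rpow_mul_one_sub_rpow {u v : ℝ} (hu : 0 < u) (hv : 0 < v) :
    IntegrableOn (fun x : ℝ => x ^ (u - 1) * (1 - x) ^ (v - 1)) (Set.Ioo 0 1) := by
  -- The integral of a non-integrable function is `0` by convention, so a nonzero value proves
  -- integrability.
  refine Integrable.of_integral_ne_zero ?_
  rw [integral_rpow_mul_one_sub_rpow hu hv]
  exact (div_pos (mul_pos (Real.Gamma_pos_of_pos hu) (Real.Gamma_pos_of_pos hv))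
    (Real.Gamma_pos_of_pos (by linarith))).ne'

/-- Expanding in powers of `1 - x` and integrating each term as a Beta integral replaces `D` by `u +
D` in the coefficients; Gauss's theorem sums the result. -/
theorem integral_ordinaryHypergeometric {A B D u : ℝ} (hu : 0 < u) (hD : 0 < D)
    (h : 0 < u + D - A - B) :
    ∫ x in Set.Ioo (0 : ℝ) 1,
        ordinaryHypergeometric A B D (1 - x) * (x ^ (u - 1) * (1 - x) ^ (D - 1)) =
      Real.Gamma u * Real.Gamma D * Real.Gamma (u + D - A - B) /
        (Real.Gamma (u + D - A) * Real.Gamma (u + D - B)) := by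
  have hDn (n : ℕ) : 0 < D + n := by positivity
  have hint (n : ℕ) : ∫ x in Set.Ioo (0 : ℝ) 1, x ^ (u - 1) * (1 - x) ^ (D + n - 1) =
      Real.Gamma u * Real.Gamma D / Real.Gamma (u + D) *
        ((ascPochhammer ℝ n).eval D * ((ascPochhammer ℝ n).eval (u + D))⁻¹) := by
    rw [integral_rpow_mul_one_sub_rpow hu (hDn n), ← add_assoc,
      Gamma_add_natCast (ne_neg_natCast_of_pos hD),
      Gamma_add_natCast (ne_neg_natCast_of_pos (add_pos hu hD))]
    have := (Real.Gamma_pos_of_pos (add_pos hu hD)).ne'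
    have := (ascPochhammer_pos n _ (add_pos hu hD)).ne'
    field_simp
  set F : ℕ → ℝ → ℝ := fun n x =>
    ordinaryHypergeometricCoefficient A B D n * (x ^ (u - 1) * (1 - x) ^ (D + n - 1)) with hF
  set K := Real.Gamma u * Real.Gamma D / Real.Gamma (u + D) with hK
  have hcoef (n : ℕ) : ordinaryHypergeometricCoefficient A B D n *
      (K * ((ascPochhammer ℝ n).eval D * ((ascPochhammer ℝ n).eval (u + D))⁻¹)) =
      K * ordinaryHypergeometricCoefficient A B (u + D) n := by
    have := (ascPochhammer_pos n _ hD).ne'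
    simp only [ordinaryHypergeometricCoefficient]
    field_simp
  have hI (n : ℕ) : ∫ x in Set.Ioo (0 : ℝ) 1, F n x =
      K * ordinaryHypergeometricCoefficient A B (u + D) n := by
    rw [hF, integral_const_mul, hint, hcoef]
  have hsum := summable_coefficient (A := A) (B := B) (add_pos hu hD) h
  have hKpos : 0 < K := div_pos (mul_pos (Real.Gamma_pos_of_pos hu) (Real.Gamma_pos_of_pos hD))
    (Real.Gamma_pos_of_pos (add_pos hu hD))
  -- Each `F n` is a constant times a nonnegative function, so the integral of its norm is the norm
  -- of its integral. Absolute convergence at `u + D` then justifies exchanging sum and integral.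
  have hnorm (n : ℕ) : ∫ x in Set.Ioo (0 : ℝ) 1, ‖F n x‖ =
      ‖K * ordinaryHypergeometricCoefficient A B (u + D) n‖ := by
    rw [← hcoef, norm_mul, ← hint, Real.norm_of_nonneg (setIntegral_nonneg measurableSet_Ioo _),
      ← integral_const_mul]
    · refine setIntegral_congr_fun measurableSet_Ioo fun x hx => ?_
      have h1 : 0 < x := hx.1
      have h2 : 0 < 1 - x := sub_pos.2 hx.2
      simp only [hF, norm_mul]
      rw [Real.norm_of_nonneg (Real.rpow_nonneg h1.le _),
        Real.norm_of_nonneg (Real.rpow_nonneg h2.le _)]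
    · intro x hx
      have h1 : 0 < x := hx.1
      have h2 : 0 < 1 - x := sub_pos.2 hx.2
      positivity
  have hs := hasSum_integral_of_summable_integral_norm (μ := volume.restrict (Set.Ioo (0 : ℝ) 1))
    (F := F) (fun n => (integrableOn_rpow_mul_one_sub_rpow hu (hDn n)).const_mul _)
    (by simpa only [hnorm] using (hsum.mul_left K).norm)
  have htsum : ∫ x in Set.Ioo (0 : ℝ) 1,
        ordinaryHypergeometric A B D (1 - x) * (x ^ (u - 1) * (1 - x) ^ (D - 1)) =
      ∫ x in Set.Ioo (0 : ℝ) 1, ∑' n, F n x := by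
    refine setIntegral_congr_fun measurableSet_Ioo fun x hx => ?_
    have h2 : 0 < 1 - x := sub_pos.2 hx.2
    simp only [ordinaryHypergeometric_eq_tsum, ← tsum_mul_right, hF, smul_eq_mul]
    refine tsum_congr fun n => ?_
    rw [show D + n - 1 = D - 1 + n by ring, Real.rpow_add h2, Real.rpow_natCast]
    ring
  rw [htsum, ← hs.tsum_eq]
  simp only [hI]
  rw [tsum_mul_left, tsum_coefficient_eq (add_pos hu hD) h, hK]
  have := (Real.Gamma_pos_of_pos (add_pos hu hD)).ne'
  field_simp

/-! ### Parity splitting and interpolation at `0, 1, …, n` -/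

theorem sum_range_succ_eq_even_add_odd (f : ℕ → ℝ) (n : ℕ) :
    ∑ j ∈ Finset.range (n + 1), f j = ∑ i ∈ Finset.range (n / 2 + 1), f (2 * i) +
      ∑ i ∈ Finset.range ((n + 1) / 2), f (2 * i + 1) := by
  induction n with
  | zero => simp
  | succ n ih =>
    rw [Finset.sum_range_succ, ih]
    obtain ⟨m, rfl | rfl⟩ := n.even_or_odd'
    · rw [show (2 * m + 1) / 2 = m by omega, show 2 * m / 2 = m by omega,
        show (2 * m + 1 + 1) / 2 = m + 1 by omega, Finset.sum_range_succ _ m,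
        Finset.sum_range_succ _ m]
      ring
    · rw [show (2 * m + 1 + 1) / 2 = m + 1 by omega, show (2 * m + 1) / 2 = m by omega,
        show (2 * m + 1 + 1 + 1) / 2 = m + 1 by omega, Finset.sum_range_succ _ (m + 1),
        show 2 * m + 1 + 1 = 2 * (m + 1) by ring]
      ring

theorem eval_eq_sum_range_of_degree_lt {p : ℝ[X]} {N : ℕ} (hp : p.degree < N) (x : ℝ) :
    p.eval x = ∑ i ∈ Finset.range N, p.coeff i * x ^ i := by
  rw [eval_eq_sum, sum_def]
  refine Finset.sum_subset (fun i hi => ?_) fun i _ hi => ?_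
  · by_contra h
    exact (mem_support_iff.1 hi) (coeff_eq_zero_of_degree_lt
      (hp.trans_le (by exact_mod_cast (by simpa using h : N ≤ i))))
  · rw [notMem_support_iff.1 hi, zero_mul]

/-- Subtracting `p.coeff n` times the falling factorial leaves degree below `n` and `n` zeros, hence
`0`. -/
theorem eval_eq_coeff_mul_factorial {p : ℝ[X]} {n : ℕ} (hp : p.natDegree ≤ n)
    (h : ∀ k < n, p.eval (k : ℝ) = 0) : p.eval (n : ℝ) = p.coeff n * (n ! : ℝ) := by
  have hm := monic_descPochhammer ℝ n
  have hdeg := descPochhammer_natDegree (R := ℝ) n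
  have hcoeff : (descPochhammer ℝ n).coeff n = 1 := by
    have := hm.leadingCoeff
    rwa [leadingCoeff, hdeg] at this
  have key : p - C (p.coeff n) * descPochhammer ℝ n = 0 := by
    refine eq_zero_of_degree_lt_of_eval_index_eq_zero (s := Finset.range n)
      (v := fun k : ℕ => (k : ℝ)) Nat.cast_injective.injOn ?_ fun k hk => ?_
    · rw [Finset.card_range, degree_lt_iff_coeff_zero]
      intro m hm
      rcases hm.eq_or_lt with rfl | hlt
      · simp [hcoeff]
      · rw [coeff_sub, coeff_C_mul, coeff_eq_zero_of_natDegree_lt (hp.trans_lt hlt),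
          coeff_eq_zero_of_natDegree_lt (hdeg.trans_lt hlt), mul_zero, sub_zero]
    · have hk' := Finset.mem_range.1 hk
      rw [eval_sub, eval_mul, h k hk', descPochhammer_eval_coe_nat_of_lt hk', mul_zero, sub_zero]
  rw [sub_eq_zero] at key
  conv_lhs => rw [key]
  rw [eval_mul, eval_C, descPochhammer_eval_eq_descFactorial, Nat.descFactorial_self]

/-! ### Linear independence of the mixed products -/

/-- The polynomial `∏_{r < j} (X + u r) ∏_{j ≤ r < n} (X + v r)`. -/
noncomputable def mixedProd (u v : ℕ → ℝ) (n j : ℕ) : ℝ[X] :=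
  (∏ r ∈ Finset.range j, (X + C (u r))) * ∏ r ∈ Finset.Ico j n, (X + C (v r))

theorem mixedProd_monic (u v : ℕ → ℝ) (n j : ℕ) : (mixedProd u v n j).Monic :=
  (monic_prod_of_monic _ _ fun r _ => monic_X_add_C (u r)).mul
    (monic_prod_of_monic _ _ fun r _ => monic_X_add_C (v r))

theorem natDegree_mixedProd (u v : ℕ → ℝ) {n j : ℕ} (h : j ≤ n) :
    (mixedProd u v n j).natDegree = n := by
  rw [mixedProd, (monic_prod_of_monic _ _ fun r _ => monic_X_add_C (u r)).natDegree_mul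
    (monic_prod_of_monic _ _ fun r _ => monic_X_add_C (v r)),
    natDegree_prod_of_monic _ _ fun r _ => monic_X_add_C (u r),
    natDegree_prod_of_monic _ _ fun r _ => monic_X_add_C (v r)]
  simp only [natDegree_X_add_C, Finset.sum_const, Finset.card_range, Nat.card_Ico, smul_eq_mul]
  omega

theorem mixedProd_succ_succ (u v : ℕ → ℝ) (n j : ℕ) :
    mixedProd u v (n + 1) (j + 1) =
      (X + C (u 0)) * mixedProd (fun r => u (r + 1)) (fun r => v (r + 1)) n j := by
  rw [mixedProd, mixedProd, Finset.prod_range_succ', ← Finset.prod_Ico_add']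
  ring

/-- At `-u 0` every product with `j ≥ 1` vanishes and the one with `j = 0` does not, so `γ 0 = 0`.
Cancelling the common factor `X + u 0` leaves the same problem for the shifted sequences. -/
theorem eq_zero_of_sum_mixedProd_eq_zero {n : ℕ} {u v γ : ℕ → ℝ}
    (huv : ∀ r s, r ≤ s → v s ≠ u r)
    (h : ∑ j ∈ Finset.range (n + 1), C (γ j) * mixedProd u v n j = 0) {j : ℕ} (hj : j ≤ n) :
    γ j = 0 := by
  induction n generalizing u v γ j with
  | zero =>
    obtain rfl : j = 0 := by omega
    simpa [mixedProd] using h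
  | succ n ih =>
    rw [Finset.sum_range_succ'] at h
    simp only [mixedProd_succ_succ] at h
    have h0 : γ 0 = 0 := by
      have he := congrArg (eval (-u 0)) h
      simp only [eval_add, eval_finsetSum, eval_mul, eval_C, eval_X, neg_add_cancel, zero_mul,
        mul_zero, Finset.sum_const_zero, zero_add, eval_zero, mixedProd, Finset.range_zero,
        Finset.prod_empty, one_mul, eval_prod] at he
      refine (_root_.mul_eq_zero.1 he).resolve_right (Finset.prod_ne_zero_iff.2 fun r _ hr => ?_)
      exact huv 0 r (Nat.zero_le r) (by linarith)
    rw [h0, C_0, zero_mul, add_zero] at h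
    have h' : (X + C (u 0)) * ∑ j ∈ Finset.range (n + 1), C (γ (j + 1)) *
        mixedProd (fun r => u (r + 1)) (fun r => v (r + 1)) n j = 0 := by
      rw [← h, Finset.mul_sum]
      exact Finset.sum_congr rfl fun j _ => by ring
    have hs := (_root_.mul_eq_zero.1 h').resolve_left (X_add_C_ne_zero _)
    rcases j with _ | j
    · exact h0
    · exact ih (γ := fun j => γ (j + 1)) (fun r s hrs => huv _ _ (by omega)) hs (by omega)

theorem natDegree_sum_mixedProd_le (u v γ : ℕ → ℝ) (n : ℕ) :
    (∑ j ∈ Finset.range (n + 1), C (γ j) * mixedProd u v n j).natDegree ≤ n :=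
  natDegree_sum_le_of_forall_le _ _ fun _ hj => (natDegree_C_mul_le _ _).trans
    (natDegree_mixedProd u v (Nat.lt_succ_iff.1 (Finset.mem_range.1 hj))).le

theorem coeff_sum_mixedProd (u v γ : ℕ → ℝ) (n : ℕ) :
    (∑ j ∈ Finset.range (n + 1), C (γ j) * mixedProd u v n j).coeff n =
      ∑ j ∈ Finset.range (n + 1), γ j := by
  rw [finsetSum_coeff]
  refine Finset.sum_congr rfl fun j hj => ?_
  have hd := natDegree_mixedProd u v (Nat.lt_succ_iff.1 (Finset.mem_range.1 hj))
  have hl := (mixedProd_monic u v n j).leadingCoeff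
  rw [leadingCoeff, hd] at hl
  rw [coeff_C_mul, hl, mul_one]

theorem eval_mixedProd (u v : ℕ → ℝ) {n j : ℕ} (hj : j ≤ n) {x : ℝ}
    (hv : ∀ r, x + v r ≠ 0) :
    ∏ r ∈ Finset.range j, (x + u r) / (x + v r) =
      (mixedProd u v n j).eval x / ∏ r ∈ Finset.range n, (x + v r) := by
  rw [← Finset.prod_range_mul_prod_Ico _ hj, Finset.prod_div_distrib, mixedProd, eval_mul,
    eval_prod, eval_prod]
  simp only [eval_add, eval_X, eval_C]
  rw [mul_div_mul_right _ _ (Finset.prod_ne_zero_iff.2 fun r _ => hv r)]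

/-! ### Interlaced parameters and Pochhammer ratios -/

/-- The sequence `x, y, x + 1, y + 1, x + 2, …`. -/
noncomputable def interlace (x y : ℝ) (r : ℕ) : ℝ :=
  if Even r then x + (r / 2 : ℕ) else y + (r / 2 : ℕ)

theorem interlace_even (x y : ℝ) (i : ℕ) : interlace x y (2 * i) = x + i := by
  simp [interlace]

theorem interlace_odd (x y : ℝ) (i : ℕ) : interlace x y (2 * i + 1) = y + i := by
  rw [interlace, if_neg (by simp), show (2 * i + 1) / 2 = i by omega]

theorem interlace_ne_interlace {a b c d : ℝ}
    (hda : ∀ k : ℕ, d - a ≠ -(k : ℝ)) (hdb : ∀ k : ℕ, d - b ≠ -(k : ℝ))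
    (hca : ∀ k : ℕ, c + 1 - a ≠ -(k : ℝ)) (hcb : ∀ k : ℕ, c - b ≠ -(k : ℝ)) (r s : ℕ)
    (hrs : r ≤ s) : interlace c d s ≠ interlace b a r := by
  intro h
  obtain ⟨i, rfl | rfl⟩ := s.even_or_odd' <;> obtain ⟨j, rfl | rfl⟩ := r.even_or_odd' <;>
    simp only [interlace_even, interlace_odd] at h
  · refine hcb (i - j) ?_
    rw [Nat.cast_sub (by omega)]
    linarith
  -- Here `2j + 1 ≤ 2i` forces `j + 1 ≤ i`, hence `c + 1 - a` rather than `c - a`.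
  · refine hca (i - (j + 1)) ?_
    rw [Nat.cast_sub (by omega)]
    push_cast
    linarith
  · refine hdb (i - j) ?_
    rw [Nat.cast_sub (by omega)]
    linarith
  · refine hda (i - j) ?_
    rw [Nat.cast_sub (by omega)]
    linarith

theorem natCast_add_interlace_ne_zero {c d : ℝ} (hc : ∀ k : ℕ, c ≠ -(k : ℝ))
    (hd : ∀ k : ℕ, d ≠ -(k : ℝ)) (k r : ℕ) : (k : ℝ) + interlace c d r ≠ 0 := by
  intro h
  obtain ⟨i, rfl | rfl⟩ := r.even_or_odd' <;> simp only [interlace_even, interlace_odd] at h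
  · refine hc (k + i) ?_
    push_cast
    linarith
  · refine hd (k + i) ?_
    push_cast
    linarith

theorem poch_succ (x : ℝ) (n : ℕ) : poch x (n + 1) = poch x n * (x + n) :=
  ascPochhammer_succ_eval n x

theorem poch_add (x : ℝ) (n m : ℕ) : poch x (n + m) = poch x n * poch (x + n) m := by
  induction m with
  | zero => simp [poch]
  | succ m ih =>
    rw [← add_assoc, poch_succ, poch_succ, ih]
    push_cast
    ring

theorem poch_ne_zero {x : ℝ} (hx : ∀ k : ℕ, x ≠ -(k : ℝ)) (n : ℕ) : poch x n ≠ 0 := by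
  rw [poch, ascPochhammer_eval_eq_prod_range]
  exact Finset.prod_ne_zero_iff.2 fun j _ h => hx j (by linarith)

theorem poch_pos {x : ℝ} (hx : 0 < x) (n : ℕ) : 0 < poch x n :=
  ascPochhammer_pos n x hx

theorem prod_range_even_interlace (x y t : ℝ) (m : ℕ) :
    ∏ r ∈ Finset.range (2 * m), (t + interlace x y r) = poch (x + t) m * poch (y + t) m := by
  induction m with
  | zero => simp [poch]
  | succ m ih =>
    rw [show 2 * (m + 1) = 2 * m + 1 + 1 by ring, Finset.prod_range_succ, Finset.prod_range_succ,
      ih, interlace_even, interlace_odd, poch_succ, poch_succ]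
    ring

/-- The moment `(a)_k (b)_k / ((c)_k (d)_k)` of the first weight. -/
noncomputable def pochRatio (a b c d : ℝ) (k : ℕ) : ℝ :=
  poch a k * poch b k / (poch c k * poch d k)

theorem pochRatio_ne_zero {a b c d : ℝ} (ha : 0 < a) (hb : 0 < b)
    (hc : ∀ k : ℕ, c ≠ -(k : ℝ)) (hd : ∀ k : ℕ, d ≠ -(k : ℝ)) (k : ℕ) :
    pochRatio a b c d k ≠ 0 :=
  div_ne_zero (mul_ne_zero (poch_pos ha k).ne' (poch_pos hb k).ne')
    (mul_ne_zero (poch_ne_zero hc k) (poch_ne_zero hd k))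

theorem pochRatio_add (a b c d : ℝ) (k i : ℕ) :
    pochRatio a b c d (k + i) = pochRatio a b c d k * ∏ r ∈ Finset.range (2 * i),
      ((k : ℝ) + interlace b a r) / (k + interlace c d r) := by
  rw [Finset.prod_div_distrib, prod_range_even_interlace, prod_range_even_interlace, pochRatio,
    pochRatio, poch_add, poch_add, poch_add, poch_add, _root_.div_mul_div_comm]
  ring

theorem pochRatio_shift {b c : ℝ} (a d : ℝ) (hb : 0 < b) (hc : ∀ k : ℕ, c ≠ -(k : ℝ)) (k : ℕ) :
    pochRatio a (b + 1) (c + 1) d k = c / b * (pochRatio a b c d k * ((b + k) / (c + k))) := by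
  have hc0 : c ≠ 0 := by simpa using hc 0
  have hck : c + k ≠ 0 := fun h => hc k (by linarith)
  have key (x : ℝ) : x * poch (x + 1) k = poch x k * (x + k) := by
    rw [← poch_succ, add_comm k 1, poch_add, Nat.cast_one]
    simp [poch]
  have h1 : poch (b + 1) k = poch b k * (b + k) / b := by
    rw [eq_div_iff hb.ne', ← key, mul_comm]
  have h2 : poch (c + 1) k = poch c k * (c + k) / c := by
    rw [eq_div_iff hc0, ← key, mul_comm]
  have := poch_ne_zero hc k
  rw [pochRatio, pochRatio, h1, h2]
  field_simp

/-- The shift in `b` and `c` contributes one further factor, the next in the interlaced order. Even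
and odd numbers of factors thus form a single family. -/
theorem pochRatio_shift_add {b c : ℝ} (a d : ℝ) (hb : 0 < b) (hc : ∀ k : ℕ, c ≠ -(k : ℝ))
    (k i : ℕ) :
    pochRatio a (b + 1) (c + 1) d (k + i) = c / b * (pochRatio a b c d k *
      ∏ r ∈ Finset.range (2 * i + 1), ((k : ℝ) + interlace b a r) / (k + interlace c d r)) := by
  rw [pochRatio_shift a d hb hc, pochRatio_add, Finset.prod_range_succ, interlace_even,
    interlace_even]
  push_cast
  ring_nf

/-! ### Moments of the two weights -/

section Moments

variable {a b c d : ℝ}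

theorem integral_pow_mul_w₁_mul_density (ha : 0 < a) (hb : 0 < b)
    (hδ : 0 < c + d - a - b) (hc : ∀ k : ℕ, c ≠ -(k : ℝ)) (hd : ∀ k : ℕ, d ≠ -(k : ℝ)) (k : ℕ) :
    ∫ x in Set.Ioo (0 : ℝ) 1, x ^ k * w₁ a b c d x * density a b c d x = pochRatio a b c d k := by
  have hk : (0 : ℝ) ≤ k := k.cast_nonneg
  have hI := integral_ordinaryHypergeometric (A := c - b) (B := d - b) (D := c + d - a - b)
    (u := a + k) (by linarith) hδ (by linarith)
  rw [show a + k + (c + d - a - b) - (c - b) - (d - b) = b + k by ring,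
    show a + k + (c + d - a - b) - (c - b) = d + k by ring,
    show a + k + (c + d - a - b) - (d - b) = c + k by ring,
    Gamma_add_natCast (ne_neg_natCast_of_pos ha), Gamma_add_natCast (ne_neg_natCast_of_pos hb),
    Gamma_add_natCast hc, Gamma_add_natCast hd] at hI
  have hcongr : ∫ x in Set.Ioo (0 : ℝ) 1, x ^ k * w₁ a b c d x * density a b c d x =
      Real.Gamma c * Real.Gamma d / (Real.Gamma a * Real.Gamma b * Real.Gamma (delta a b c d)) *
      ∫ x in Set.Ioo (0 : ℝ) 1, ordinaryHypergeometric (c - b) (d - b) (c + d - a - b) (1 - x) *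
        (x ^ (a + k - 1) * (1 - x) ^ (c + d - a - b - 1)) := by
    rw [← integral_const_mul]
    refine setIntegral_congr_fun measurableSet_Ioo fun x hx => ?_
    simp only [w₁, density, delta]
    rw [show a + k - 1 = a - 1 + k by ring, Real.rpow_add hx.1, Real.rpow_natCast]
    ring
  rw [hcongr, hI, delta, pochRatio, poch, poch, poch, poch]
  have h1 := (Real.Gamma_pos_of_pos ha).ne'
  have h2 := (Real.Gamma_pos_of_pos hb).ne'
  have h3 := (Real.Gamma_pos_of_pos hδ).ne'
  have h4 := Real.Gamma_ne_zero hc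
  have h5 := Real.Gamma_ne_zero hd
  have h6 := poch_ne_zero hc k
  have h7 := poch_ne_zero hd k
  rw [poch] at h6 h7
  field_simp

theorem integrableOn_pow_mul_w₁_mul_density (ha : 0 < a) (hb : 0 < b)
    (hδ : 0 < c + d - a - b) (hc : ∀ k : ℕ, c ≠ -(k : ℝ)) (hd : ∀ k : ℕ, d ≠ -(k : ℝ)) (k : ℕ) :
    IntegrableOn (fun x => x ^ k * w₁ a b c d x * density a b c d x) (Set.Ioo 0 1) := by
  refine Integrable.of_integral_ne_zero ?_
  rw [integral_pow_mul_w₁_mul_density ha hb hδ hc hd]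
  exact pochRatio_ne_zero ha hb hc hd k

/-- The shift `b + 1, c + 1` fixes `δ`, and `Γ(c + 1) / Γ(b + 1)` supplies the factor `c / b`. Facts
about `w₁` thereby transfer to `w₂`. -/
theorem w₂_mul_density (hb : 0 < b) (hc : ∀ k : ℕ, c ≠ -(k : ℝ)) (x : ℝ) :
    w₂ a b c d x * density a b c d x =
      w₁ a (b + 1) (c + 1) d x * density a (b + 1) (c + 1) d x := by
  have hc0 : c ≠ 0 := by simpa using hc 0
  have hδ : delta a (b + 1) (c + 1) d = delta a b c d := by
    simp only [delta]
    ring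
  simp only [w₁, w₂, density, hδ]
  rw [Real.Gamma_add_one hc0, Real.Gamma_add_one hb.ne', show c + 1 - (b + 1) = c - b by ring,
    show d - (b + 1) = d - b - 1 by ring]
  field_simp

theorem add_one_ne_neg_natCast (hc : ∀ k : ℕ, c ≠ -(k : ℝ)) (k : ℕ) : c + 1 ≠ -(k : ℝ) := by
  intro h
  refine hc (k + 1) ?_
  push_cast
  linarith

theorem integral_pow_mul_w₂_mul_density (ha : 0 < a) (hb : 0 < b)
    (hδ : 0 < c + d - a - b) (hc : ∀ k : ℕ, c ≠ -(k : ℝ)) (hd : ∀ k : ℕ, d ≠ -(k : ℝ)) (k : ℕ) :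
    ∫ x in Set.Ioo (0 : ℝ) 1, x ^ k * w₂ a b c d x * density a b c d x =
      pochRatio a (b + 1) (c + 1) d k := by
  simp only [mul_assoc, w₂_mul_density hb hc]
  simp only [← mul_assoc]
  exact integral_pow_mul_w₁_mul_density ha (by linarith) (by linarith)
    (add_one_ne_neg_natCast hc) hd k

theorem integrableOn_pow_mul_w₂_mul_density (ha : 0 < a) (hb : 0 < b)
    (hδ : 0 < c + d - a - b) (hc : ∀ k : ℕ, c ≠ -(k : ℝ)) (hd : ∀ k : ℕ, d ≠ -(k : ℝ)) (k : ℕ) :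
    IntegrableOn (fun x => x ^ k * w₂ a b c d x * density a b c d x) (Set.Ioo 0 1) := by
  refine Integrable.of_integral_ne_zero ?_
  rw [integral_pow_mul_w₂_mul_density ha hb hδ hc hd]
  exact pochRatio_ne_zero ha (by linarith) (add_one_ne_neg_natCast hc) hd k

end Moments

/-! ### The step-line conditions as a linear system -/

theorem pow_mul_linearForm_mul (u₁ u₂ ρ : ℝ → ℝ) {A₁ A₂ : ℝ[X]} {ν₁ ν₂ : ℕ}
    (h₁ : A₁.degree < ν₁) (h₂ : A₂.degree < ν₂) (k : ℕ) (x : ℝ) :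
    x ^ k * linearForm u₁ u₂ A₁ A₂ x * ρ x =
      ∑ i ∈ Finset.range ν₁, A₁.coeff i * (x ^ (k + i) * u₁ x * ρ x) +
      ∑ i ∈ Finset.range ν₂, A₂.coeff i * (x ^ (k + i) * u₂ x * ρ x) := by
  rw [linearForm, eval_eq_sum_range_of_degree_lt h₁, eval_eq_sum_range_of_degree_lt h₂, mul_add,
    add_mul, Finset.mul_sum, Finset.mul_sum, Finset.mul_sum, Finset.mul_sum, Finset.sum_mul,
    Finset.sum_mul]
  congr 1 <;> exact Finset.sum_congr rfl fun i _ => by ring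

/-- The coefficients of `A₁` and of `(c / b) A₂`, interlaced. -/
noncomputable def stepCoeff (b c : ℝ) (A₁ A₂ : ℝ[X]) (j : ℕ) : ℝ :=
  if Even j then A₁.coeff (j / 2) else c / b * A₂.coeff (j / 2)

theorem stepCoeff_even (b c : ℝ) (A₁ A₂ : ℝ[X]) (i : ℕ) :
    stepCoeff b c A₁ A₂ (2 * i) = A₁.coeff i := by
  simp [stepCoeff]

theorem stepCoeff_odd (b c : ℝ) (A₁ A₂ : ℝ[X]) (i : ℕ) :
    stepCoeff b c A₁ A₂ (2 * i + 1) = c / b * A₂.coeff i := by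
  rw [stepCoeff, if_neg (by simp), show (2 * i + 1) / 2 = i by omega]

/-- The `k`-th moment of the linear form with interlaced coefficients `γ`. -/
noncomputable def stepMoment (a b c d : ℝ) (n : ℕ) (γ : ℕ → ℝ) (k : ℕ) : ℝ :=
  ∑ j ∈ Finset.range (n + 1), γ j * (pochRatio a b c d k *
    ∏ r ∈ Finset.range j, ((k : ℝ) + interlace b a r) / (k + interlace c d r))

section StepLine

variable {a b c d : ℝ} {n : ℕ} {A₁ A₂ : ℝ[X]}

theorem integrableOn_pow_mul_linearForm (ha : 0 < a) (hb : 0 < b)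
    (hδ : 0 < c + d - a - b) (hc : ∀ k : ℕ, c ≠ -(k : ℝ)) (hd : ∀ k : ℕ, d ≠ -(k : ℝ))
    {ν₁ ν₂ : ℕ} (h₁ : A₁.degree < ν₁) (h₂ : A₂.degree < ν₂) (k : ℕ) :
    IntegrableOn (fun x => x ^ k * linearForm (w₁ a b c d) (w₂ a b c d) A₁ A₂ x *
      density a b c d x) (Set.Ioo 0 1) := by
  simp only [pow_mul_linearForm_mul _ _ _ h₁ h₂]
  refine Integrable.add (integrable_finsetSum _ fun i _ => ?_)
    (integrable_finsetSum _ fun i _ => ?_)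
  · exact (integrableOn_pow_mul_w₁_mul_density ha hb hδ hc hd _).const_mul _
  · exact (integrableOn_pow_mul_w₂_mul_density ha hb hδ hc hd _).const_mul _

theorem integral_pow_mul_linearForm (ha : 0 < a) (hb : 0 < b)
    (hδ : 0 < c + d - a - b) (hc : ∀ k : ℕ, c ≠ -(k : ℝ)) (hd : ∀ k : ℕ, d ≠ -(k : ℝ))
    (h₁ : A₁.degree < (n / 2 + 1 : ℕ)) (h₂ : A₂.degree < ((n + 1) / 2 : ℕ)) (k : ℕ) :
    ∫ x in Set.Ioo (0 : ℝ) 1, x ^ k * linearForm (w₁ a b c d) (w₂ a b c d) A₁ A₂ x *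
      density a b c d x = stepMoment a b c d n (stepCoeff b c A₁ A₂) k := by
  have i₁ (i : ℕ) := (integrableOn_pow_mul_w₁_mul_density ha hb hδ hc hd (k + i)).const_mul
    (A₁.coeff i)
  have i₂ (i : ℕ) := (integrableOn_pow_mul_w₂_mul_density ha hb hδ hc hd (k + i)).const_mul
    (A₂.coeff i)
  simp only [pow_mul_linearForm_mul _ _ _ h₁ h₂]
  rw [integral_add (integrable_finsetSum _ fun i _ => i₁ i)
    (integrable_finsetSum _ fun i _ => i₂ i), integral_finsetSum _ fun i _ => i₁ i,
    integral_finsetSum _ fun i _ => i₂ i, stepMoment,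
    sum_range_succ_eq_even_add_odd (fun j => stepCoeff b c A₁ A₂ j * _)]
  refine congrArg₂ (· + ·) (Finset.sum_congr rfl fun i _ => ?_)
    (Finset.sum_congr rfl fun i _ => ?_)
  · rw [integral_const_mul, integral_pow_mul_w₁_mul_density ha hb hδ hc hd,
      pochRatio_add, stepCoeff_even]
  · rw [integral_const_mul, integral_pow_mul_w₂_mul_density ha hb hδ hc hd,
      pochRatio_shift_add a d hb hc, stepCoeff_odd]
    ring

theorem isHypergeometricTypeI_iff (ha : 0 < a) (hb : 0 < b)
    (hδ : 0 < c + d - a - b) (hc : ∀ k : ℕ, c ≠ -(k : ℝ)) (hd : ∀ k : ℕ, d ≠ -(k : ℝ)) :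
    IsHypergeometricTypeI a b c d n A₁ A₂ ↔
      A₁.degree < (n / 2 + 1 : ℕ) ∧ A₂.degree < ((n + 1) / 2 : ℕ) ∧
      ∀ k ≤ n, stepMoment a b c d n (stepCoeff b c A₁ A₂) k = if k = n then 1 else 0 := by
  have hn : n / 2 + 1 + (n + 1) / 2 = n + 1 := by omega
  constructor
  · intro h
    refine ⟨h.degree_fst, h.degree_snd, fun k hk => ?_⟩
    rw [← integral_pow_mul_linearForm ha hb hδ hc hd h.degree_fst h.degree_snd]
    split_ifs with hkn
    · exact h.normalized k (by omega)
    · exact h.orthogonal k (by omega)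
  · rintro ⟨h₁, h₂, h⟩
    refine ⟨h₁, h₂, fun j _ => integrableOn_pow_mul_linearForm ha hb hδ hc hd h₁ h₂ j,
      fun j hj => ?_, fun j hj => ?_⟩
    · rw [integral_pow_mul_linearForm ha hb hδ hc hd h₁ h₂, h j (by omega), if_neg (by omega)]
    · rw [integral_pow_mul_linearForm ha hb hδ hc hd h₁ h₂, h j (by omega), if_pos (by omega)]

/-- Over the common denominator `∏_{r < n} (k + v_r)`, the moments become values at the integers `k`
of one polynomial independent of `k`. -/
theorem stepMoment_eq (hc : ∀ k : ℕ, c ≠ -(k : ℝ)) (hd : ∀ k : ℕ, d ≠ -(k : ℝ)) (γ : ℕ → ℝ)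
    (k : ℕ) :
    stepMoment a b c d n γ k = pochRatio a b c d k *
      (∑ j ∈ Finset.range (n + 1), C (γ j) * mixedProd (interlace b a) (interlace c d) n j).eval
        (k : ℝ) / ∏ r ∈ Finset.range n, ((k : ℝ) + interlace c d r) := by
  rw [eval_finsetSum, Finset.mul_sum, Finset.sum_div, stepMoment]
  refine Finset.sum_congr rfl fun j hj => ?_
  rw [eval_mixedProd _ _ (Nat.lt_succ_iff.1 (Finset.mem_range.1 hj))
    (natCast_add_interlace_ne_zero hc hd k), eval_mul, eval_C]
  ring

theorem stepMoment_sub (γ γ' : ℕ → ℝ) (k : ℕ) :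
    stepMoment a b c d n (fun j => γ j - γ' j) k =
      stepMoment a b c d n γ k - stepMoment a b c d n γ' k := by
  simp only [stepMoment, sub_mul, Finset.sum_sub_distrib]

/-- The numerator polynomial has degree at most `n` and `n + 1` zeros, so it vanishes, and linear
independence applies. -/
theorem eq_zero_of_stepMoment_eq_zero (ha : 0 < a) (hb : 0 < b)
    (hc : ∀ k : ℕ, c ≠ -(k : ℝ)) (hd : ∀ k : ℕ, d ≠ -(k : ℝ))
    (hda : ∀ k : ℕ, d - a ≠ -(k : ℝ)) (hdb : ∀ k : ℕ, d - b ≠ -(k : ℝ))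
    (hca : ∀ k : ℕ, c + 1 - a ≠ -(k : ℝ)) (hcb : ∀ k : ℕ, c - b ≠ -(k : ℝ)) {γ : ℕ → ℝ}
    (h : ∀ k ≤ n, stepMoment a b c d n γ k = 0) {j : ℕ} (hj : j ≤ n) : γ j = 0 := by
  refine eq_zero_of_sum_mixedProd_eq_zero (interlace_ne_interlace hda hdb hca hcb) ?_ hj
  refine eq_zero_of_degree_lt_of_eval_index_eq_zero (s := Finset.range (n + 1))
    (v := fun k : ℕ => (k : ℝ)) Nat.cast_injective.injOn ?_ fun k hk => ?_
  · rw [Finset.card_range]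
    exact degree_le_natDegree.trans_lt (by
      exact_mod_cast Nat.lt_succ_of_le (natDegree_sum_mixedProd_le _ _ γ n))
  · have hk' := h k (Nat.lt_succ_iff.1 (Finset.mem_range.1 hk))
    rw [stepMoment_eq hc hd, div_eq_zero_iff] at hk'
    exact (_root_.mul_eq_zero.1 (hk'.resolve_right (Finset.prod_ne_zero_iff.2 fun r _ =>
      natCast_add_interlace_ne_zero hc hd k r))).resolve_left
      (pochRatio_ne_zero ha hb hc hd k)

/-- The system is square, so injectivity gives surjectivity. -/
theorem exists_stepMoment_eq (ha : 0 < a) (hb : 0 < b)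
    (hc : ∀ k : ℕ, c ≠ -(k : ℝ)) (hd : ∀ k : ℕ, d ≠ -(k : ℝ))
    (hda : ∀ k : ℕ, d - a ≠ -(k : ℝ)) (hdb : ∀ k : ℕ, d - b ≠ -(k : ℝ))
    (hca : ∀ k : ℕ, c + 1 - a ≠ -(k : ℝ)) (hcb : ∀ k : ℕ, c - b ≠ -(k : ℝ)) (n : ℕ)
    (y : ℕ → ℝ) : ∃ γ : ℕ → ℝ, ∀ k ≤ n, stepMoment a b c d n γ k = y k := by
  let M : Matrix (Fin (n + 1)) (Fin (n + 1)) ℝ := fun k j => pochRatio a b c d k *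
    ∏ r ∈ Finset.range j, (((k : ℕ) : ℝ) + interlace b a r) / ((k : ℕ) + interlace c d r)
  let ext (g : Fin (n + 1) → ℝ) (j : ℕ) : ℝ := if h : j < n + 1 then g ⟨j, h⟩ else 0
  have hM (g : Fin (n + 1) → ℝ) (k : Fin (n + 1)) :
      M.mulVecLin g k = stepMoment a b c d n (ext g) k := by
    rw [stepMoment, Finset.sum_range, Matrix.mulVecLin_apply, Matrix.mulVec, dotProduct]
    refine Finset.sum_congr rfl fun j _ => ?_
    simp only [M, ext, dif_pos j.isLt]
    ring
  have hinj : Function.Injective M.mulVecLin := by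
    rw [← LinearMap.ker_eq_bot, LinearMap.ker_eq_bot']
    intro g hg
    funext j
    have := eq_zero_of_stepMoment_eq_zero (γ := ext g) ha hb hc hd hda hdb hca hcb
      (fun k hk => by rw [← hM g ⟨k, by omega⟩, hg, Pi.zero_apply])
      (Nat.lt_succ_iff.1 j.isLt)
    simpa only [ext, dif_pos j.isLt, Pi.zero_apply] using this
  obtain ⟨g, hg⟩ := LinearMap.injective_iff_surjective.1 hinj fun k => y k
  exact ⟨ext g, fun k hk => by rw [← hM g ⟨k, by omega⟩, hg]⟩

theorem exists_stepCoeff_eq (hb : 0 < b) (hc : ∀ k : ℕ, c ≠ -(k : ℝ)) (n : ℕ) (γ : ℕ → ℝ) :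
    ∃ A₁ A₂ : ℝ[X], A₁.degree < (n / 2 + 1 : ℕ) ∧ A₂.degree < ((n + 1) / 2 : ℕ) ∧
      ∀ j ≤ n, stepCoeff b c A₁ A₂ j = γ j := by
  have hc0 : c ≠ 0 := by simpa using hc 0
  refine ⟨∑ i ∈ Finset.range (n / 2 + 1), monomial i (γ (2 * i)),
    ∑ i ∈ Finset.range ((n + 1) / 2), monomial i (b / c * γ (2 * i + 1)), ?_, ?_, ?_⟩
  · refine (degree_sum_le _ _).trans_lt
      ((Finset.sup_lt_iff (WithBot.bot_lt_coe _)).2 fun i hi => ?_)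
    exact (degree_monomial_le _ _).trans_lt (by exact_mod_cast Finset.mem_range.1 hi)
  · refine (degree_sum_le _ _).trans_lt
      ((Finset.sup_lt_iff (WithBot.bot_lt_coe _)).2 fun i hi => ?_)
    exact (degree_monomial_le _ _).trans_lt (by exact_mod_cast Finset.mem_range.1 hi)
  · intro j hj
    obtain ⟨i, rfl | rfl⟩ := j.even_or_odd'
    · rw [stepCoeff_even, finsetSum_coeff]
      simp only [coeff_monomial, Finset.sum_ite_eq', Finset.mem_range]
      rw [if_pos (by omega)]
    · rw [stepCoeff_odd, finsetSum_coeff]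
      simp only [coeff_monomial, Finset.sum_ite_eq', Finset.mem_range]
      rw [if_pos (by omega)]
      field_simp

theorem eq_of_stepCoeff_eq {B₁ B₂ : ℝ[X]} (hb : 0 < b) (hc : ∀ k : ℕ, c ≠ -(k : ℝ))
    (h₁ : A₁.degree < (n / 2 + 1 : ℕ)) (h₂ : A₂.degree < ((n + 1) / 2 : ℕ))
    (h₁' : B₁.degree < (n / 2 + 1 : ℕ)) (h₂' : B₂.degree < ((n + 1) / 2 : ℕ))
    (h : ∀ j ≤ n, stepCoeff b c A₁ A₂ j = stepCoeff b c B₁ B₂ j) : A₁ = B₁ ∧ A₂ = B₂ := by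
  have hc0 : c ≠ 0 := by simpa using hc 0
  constructor <;> ext i
  · rcases lt_or_ge i (n / 2 + 1) with hi | hi
    · simpa only [stepCoeff_even] using h (2 * i) (by omega)
    · have hi' : ((n / 2 + 1 : ℕ) : WithBot ℕ) ≤ i := by exact_mod_cast hi
      rw [coeff_eq_zero_of_degree_lt (h₁.trans_le hi'),
        coeff_eq_zero_of_degree_lt (h₁'.trans_le hi')]
  · rcases lt_or_ge i ((n + 1) / 2) with hi | hi
    · have := h (2 * i + 1) (by omega)
      simp only [stepCoeff_odd] at this
      exact mul_left_cancel₀ (div_ne_zero hc0 hb.ne') this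
    · have hi' : (((n + 1) / 2 : ℕ) : WithBot ℕ) ≤ i := by exact_mod_cast hi
      rw [coeff_eq_zero_of_degree_lt (h₂.trans_le hi'),
        coeff_eq_zero_of_degree_lt (h₂'.trans_le hi')]

/-! ### Existence, uniqueness and the values at `1` -/

theorem existsUnique_isHypergeometricTypeI (ha : 0 < a) (hb : 0 < b)
    (hδ : 0 < c + d - a - b) (hc : ∀ k : ℕ, c ≠ -(k : ℝ)) (hd : ∀ k : ℕ, d ≠ -(k : ℝ))
    (hda : ∀ k : ℕ, d - a ≠ -(k : ℝ)) (hdb : ∀ k : ℕ, d - b ≠ -(k : ℝ))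
    (hca : ∀ k : ℕ, c + 1 - a ≠ -(k : ℝ)) (hcb : ∀ k : ℕ, c - b ≠ -(k : ℝ)) (n : ℕ) :
    ∃! A : ℝ[X] × ℝ[X], IsHypergeometricTypeI a b c d n A.1 A.2 := by
  obtain ⟨γ, hγ⟩ := exists_stepMoment_eq ha hb hc hd hda hdb hca hcb n
    fun k => if k = n then 1 else 0
  obtain ⟨A₁, A₂, h₁, h₂, hA⟩ := exists_stepCoeff_eq hb hc n γ
  have hmom (k : ℕ) (hk : k ≤ n) :
      stepMoment a b c d n (stepCoeff b c A₁ A₂) k = if k = n then 1 else 0 := by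
    rw [← hγ k hk]
    exact Finset.sum_congr rfl fun j hj => by rw [hA j (Nat.lt_succ_iff.1 (Finset.mem_range.1 hj))]
  refine ⟨(A₁, A₂), (isHypergeometricTypeI_iff ha hb hδ hc hd).2 ⟨h₁, h₂, hmom⟩, ?_⟩
  rintro ⟨B₁, B₂⟩ hB
  obtain ⟨h₁', h₂', hmom'⟩ := (isHypergeometricTypeI_iff ha hb hδ hc hd).1 hB
  obtain ⟨e₁, e₂⟩ := eq_of_stepCoeff_eq hb hc h₁' h₂' h₁ h₂ fun j hj => sub_eq_zero.1 <|
    eq_zero_of_stepMoment_eq_zero ha hb hc hd hda hdb hca hcb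
      (γ := fun j => stepCoeff b c B₁ B₂ j - stepCoeff b c A₁ A₂ j)
      (fun k hk => by rw [stepMoment_sub, hmom k hk, hmom' k hk, sub_self]) hj
  exact Prod.ext e₁ e₂

theorem q_one_eq_sum_stepCoeff (h₁ : A₁.degree < (n / 2 + 1 : ℕ))
    (h₂ : A₂.degree < ((n + 1) / 2 : ℕ)) :
    q a b c d A₁ A₂ 1 = ∑ j ∈ Finset.range (n + 1), stepCoeff b c A₁ A₂ j := by
  rw [q, linearForm, w₁, w₂, sub_self, ordinaryHypergeometric_zero, ordinaryHypergeometric_zero,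
    eval_eq_sum_range_of_degree_lt h₁, eval_eq_sum_range_of_degree_lt h₂,
    sum_range_succ_eq_even_add_odd (stepCoeff b c A₁ A₂)]
  simp only [stepCoeff_even, stepCoeff_odd, one_pow, mul_one, one_mul, Finset.mul_sum]

/-- `q(1)` is the coefficient of degree `n` of the numerator polynomial. Orthogonality makes that
polynomial a multiple of the falling factorial, and the normalization fixes the multiple. -/
theorem q_one_eq (ha : 0 < a) (hb : 0 < b)
    (hδ : 0 < c + d - a - b) (hc : ∀ k : ℕ, c ≠ -(k : ℝ)) (hd : ∀ k : ℕ, d ≠ -(k : ℝ))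
    (h : IsHypergeometricTypeI a b c d n A₁ A₂) :
    q a b c d A₁ A₂ 1 = 1 / (n ! : ℝ) *
      ((∏ r ∈ Finset.range n, ((n : ℝ) + interlace c d r)) / pochRatio a b c d n) := by
  obtain ⟨h₁, h₂, hmom⟩ := (isHypergeometricTypeI_iff ha hb hδ hc hd).1 h
  have hV (k : ℕ) : ∏ r ∈ Finset.range n, ((k : ℝ) + interlace c d r) ≠ 0 :=
    Finset.prod_ne_zero_iff.2 fun r _ => natCast_add_interlace_ne_zero hc hd k r
  have hm := pochRatio_ne_zero ha hb hc hd
  simp only [stepMoment_eq hc hd] at hmom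
  rw [q_one_eq_sum_stepCoeff (a := a) (d := d) h₁ h₂,
    ← coeff_sum_mixedProd (interlace b a) (interlace c d)]
  have he := eval_eq_coeff_mul_factorial
    (natDegree_sum_mixedProd_le (interlace b a) (interlace c d) (stepCoeff b c A₁ A₂) n)
    fun k hk => by
      have := hmom k hk.le
      rw [if_neg hk.ne, div_eq_zero_iff] at this
      exact (_root_.mul_eq_zero.1 (this.resolve_right (hV k))).resolve_left (hm k)
  have hn := hmom n le_rfl
  rw [if_pos rfl, he, div_eq_one_iff_eq (hV n)] at hn
  have hf : (n ! : ℝ) ≠ 0 := by positivity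
  rw [← hn]
  field_simp [hm n]

theorem q_one_even (ha : 0 < a) (hb : 0 < b)
    (hδ : 0 < c + d - a - b) (hc : ∀ k : ℕ, c ≠ -(k : ℝ)) (hd : ∀ k : ℕ, d ≠ -(k : ℝ)) {m : ℕ}
    (h : IsHypergeometricTypeI a b c d (2 * m) A₁ A₂) :
    q a b c d A₁ A₂ 1 = 1 / ((2 * m)! : ℝ) *
      (poch c (3 * m) * poch d (3 * m) / (poch a (2 * m) * poch b (2 * m))) := by
  rw [q_one_eq ha hb hδ hc hd h, prod_range_even_interlace, pochRatio,
    -- The product at `k = 2m` supplies `(c + 2m)_m (d + 2m)_m`, which extends the `(c)_{2m}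
    -- (d)_{2m}` of the moment to length `3m`.
    show 3 * m = 2 * m + m by ring, poch_add c, poch_add d, div_div_eq_mul_div]
  congr 2
  ring

theorem q_one_odd (ha : 0 < a) (hb : 0 < b)
    (hδ : 0 < c + d - a - b) (hc : ∀ k : ℕ, c ≠ -(k : ℝ)) (hd : ∀ k : ℕ, d ≠ -(k : ℝ)) {m : ℕ}
    (h : IsHypergeometricTypeI a b c d (2 * m + 1) A₁ A₂) :
    q a b c d A₁ A₂ 1 = 1 / ((2 * m + 1)! : ℝ) *
      (poch c (3 * m + 2) * poch d (3 * m + 1) / (poch a (2 * m + 1) * poch b (2 * m + 1))) := by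
  rw [q_one_eq ha hb hδ hc hd h, Finset.prod_range_succ, prod_range_even_interlace,
    interlace_even, pochRatio, show 3 * m + 2 = (2 * m + 1) + (m + 1) by ring,
    show 3 * m + 1 = (2 * m + 1) + m by ring, poch_add c (2 * m + 1) (m + 1),
    poch_add d (2 * m + 1) m, poch_succ (c + _),
    div_div_eq_mul_div]
  congr 2
  ring

end StepLine

end HypergeometricMOP

theorem mainTheorem1 (a b c d : ℝ)
    (ha : 0 < a) (hb : 0 < b) (hδ : 0 < c + d - a - b)
    (hc : ∀ k : ℕ, c ≠ -(k : ℝ)) (hd : ∀ k : ℕ, d ≠ -(k : ℝ))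
    (hda : ∀ k : ℕ, d - a ≠ -(k : ℝ)) (hdb : ∀ k : ℕ, d - b ≠ -(k : ℝ))
    (hca : ∀ k : ℕ, c + 1 - a ≠ -(k : ℝ)) (hcb : ∀ k : ℕ, c - b ≠ -(k : ℝ)) :
    (∀ n : ℕ, ∃! A : ℝ[X] × ℝ[X], HypergeometricMOP.IsHypergeometricTypeI a b c d n A.1 A.2) ∧
    ∀ A₁ A₂ : ℕ → ℝ[X],
      (∀ n : ℕ, HypergeometricMOP.IsHypergeometricTypeI a b c d n (A₁ n) (A₂ n)) →
      (∀ n : ℕ, HypergeometricMOP.q a b c d (A₁ (2 * n)) (A₂ (2 * n)) 1 =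
        1 / ((2 * n)! : ℝ) *
          (HypergeometricMOP.poch c (3 * n) * HypergeometricMOP.poch d (3 * n) /
            (HypergeometricMOP.poch a (2 * n) * HypergeometricMOP.poch b (2 * n)))) ∧
      (∀ n : ℕ, HypergeometricMOP.q a b c d (A₁ (2 * n + 1)) (A₂ (2 * n + 1)) 1 =
        1 / ((2 * n + 1)! : ℝ) *
          (HypergeometricMOP.poch c (3 * n + 2) * HypergeometricMOP.poch d (3 * n + 1) /
            (HypergeometricMOP.poch a (2 * n + 1) * HypergeometricMOP.poch b (2 * n + 1)))) ∧
      (0 < c → 0 < d → ∀ n : ℕ, 0 < HypergeometricMOP.q a b c d (A₁ n) (A₂ n) 1) := by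
  refine ⟨HypergeometricMOP.existsUnique_isHypergeometricTypeI ha hb hδ hc hd hda hdb hca hcb,
    fun A₁ A₂ hA => ⟨fun n => HypergeometricMOP.q_one_even ha hb hδ hc hd (hA _),
      fun n => HypergeometricMOP.q_one_odd ha hb hδ hc hd (hA _), fun hc' hd' n => ?_⟩⟩
  have pa := HypergeometricMOP.poch_pos ha
  have pb := HypergeometricMOP.poch_pos hb
  have pc := HypergeometricMOP.poch_pos hc'
  have pd := HypergeometricMOP.poch_pos hd'
  have hf : 0 < (n ! : ℝ) := by exact_mod_cast Nat.factorial_pos n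
  obtain ⟨m, rfl | rfl⟩ := n.even_or_odd'
  · rw [HypergeometricMOP.q_one_even ha hb hδ hc hd (hA _)]
    exact mul_pos (one_div_pos.2 hf) (div_pos (mul_pos (pc _) (pd _)) (mul_pos (pa _) (pb _)))
  · rw [HypergeometricMOP.q_one_odd ha hb hδ hc hd (hA _)]
    exact mul_pos (one_div_pos.2 hf) (div_pos (mul_pos (pc _) (pd _)) (mul_pos (pa _) (pb _)))
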